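/- Setting. Let $(\Omega,\mathcal P)$ be a probability space and $0<A<B<1$. Let $(a_n,b_n)_{n\ge1}$ be independent, identically distributed random pairs with values in $\{(x,y)\in[0,1]^2: A\le\min(x,y)<x+y\le B\}$, and let $(p_n)_{n\ge 1}$ be i.i.d. random variables in $[0,1]$, independent of $(a_n,b_n)_{n\ge1}$, such that for some $t>0$ the expectations $\mathbb E(a_1^{-t})$, $\mathbb E(b_1^{-t})$, $\mathbb E(p_1^{-t})$ and $\mathbb E((1-p_1)^{-t})$ are finite. For $\omega\in\Omega$ define the Moran intervals of step $n$ inductively: the only Moran interval of step $0$ is $[0,1]$, and each Moran interval $I$ of step $n-1$ has two children of step $n$, namely the left-most closed subinterval of $I$ of length $a_n(\omega)|I|$ and the right-most closed subinterval of $I$ of length $b_n(\omega)|I|$. Let $\mu_\omega$ be the Borel probability measure determined by $\mu_\omega([0,1])=1$ and the rule that, if $I$ is a Moran interval of step $n-1$, then its left child has measure $p_n(\omega)\mu_\omega(I)$ and its right child has measure $(1-p_n(\omega))\mu_\omega(I)$. For a finite Borel measure $\mu$ on a metric space (with $B(x,r)$ the open ball), the (upper) Assouad dimension $\dim_A\mu\in[-\infty,\infty]$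 is the infimum of all real $d$ for which there are $C_1,C_2>0$ with $$\frac{\mu(B(x,R))}{\mu(B(x,r))}\le C_2\Big(\frac Rr\Big)^d\quad\text{for all }0<r<R\le C_1,\ R<1,\ x\in\operatorname{supp}\mu$$ (with $\inf\emptyset=\infty$), and the lower Assouad dimension $\dim_L\mu$ is the supremum of all real $d$ for which there are $C_1,C_2>0$ such that the same holds with $\ge$ in place of $\le$. Put $a_0=\operatorname{ess\,inf}a_1$, $b_0=\operatorname{ess\,inf}b_1$, $A_0=\operatorname{ess\,sup}a_1$, $B_0=\operatorname{ess\,sup}b_1$, $p_0=\operatorname{ess\,sup}p_1$, $q_0=\operatorname{ess\,sup}(1-p_1)$, $P_0=\operatorname{ess\,inf}p_1$, $Q_0=\operatorname{ess\,inf}(1-p_1)$, and $$\alpha=\max\Big(\frac{\log P_0}{\log A_0},\frac{\log Q_0}{\log B_0}\Big),\qquad \beta=\min\Big(\frac{\log p_0}{\log a_0},\frac{\log q_0}{\log b_0}\Big),$$ where $\alpha=\infty$ if $P_0=0$ or $Q_0=0$. Corollary. For $\mathcal P$-almost every $\omega$, $\dim_A\mu_\omega=\alpha$ and $\dim_L\mu_\omega=\beta$.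 -/

import Mathlib

open MeasureTheory ProbabilityTheory

noncomputable section

/-! ### Φ-dimensions and Assouad dimensions of measures -/

/-- The inequality `μ (B(x,R)) / μ (B(x,r)) ≤ C₂ (R/r)^d` holds for all `x` in the support of `μ`
and all `0 < r < R^(1+Φ(R)) ≤ R ≤ C₁`, for some constants `C₁, C₂ > 0`.
(The function `Φ` lives on `(0,1)`, hence `R < 1`; `μ` is a finite Borel measure.) -/
def IsUpperPhiBound {X : Type*} [MetricSpace X] [MeasurableSpace X]
    (Φ : ℝ → ℝ) (μ : Measure X) (d : ℝ) : Prop :=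
  ∃ C₁ > 0, ∃ C₂ > 0, ∀ r R : ℝ, 0 < r → r < R ^ (1 + Φ R) → R ^ (1 + Φ R) ≤ R → R ≤ C₁ → R < 1 →
    ∀ x ∈ μ.support, μ.real (Metric.ball x R) / μ.real (Metric.ball x r) ≤ C₂ * (R / r) ^ d

/-- As `IsUpperPhiBound`, with the inequality `μ (B(x,R)) / μ (B(x,r)) ≥ C₂ (R/r)^d`. -/
def IsLowerPhiBound {X : Type*} [MetricSpace X] [MeasurableSpace X]
    (Φ : ℝ → ℝ) (μ : Measure X) (d : ℝ) : Prop :=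
  ∃ C₁ > 0, ∃ C₂ > 0, ∀ r R : ℝ, 0 < r → r < R ^ (1 + Φ R) → R ^ (1 + Φ R) ≤ R → R ≤ C₁ → R < 1 →
    ∀ x ∈ μ.support, C₂ * (R / r) ^ d ≤ μ.real (Metric.ball x R) / μ.real (Metric.ball x r)

/-- Upper Φ-dimension of a measure (the infimum of the empty set is `∞`). -/
def upperPhiDim {X : Type*} [MetricSpace X] [MeasurableSpace X]
    (Φ : ℝ → ℝ) (μ : Measure X) : EReal :=
  sInf ((fun d : ℝ => (d : EReal)) '' {d : ℝ | IsUpperPhiBound Φ μ d})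

/-- Lower Φ-dimension of a measure. -/
def lowerPhiDim {X : Type*} [MetricSpace X] [MeasurableSpace X]
    (Φ : ℝ → ℝ) (μ : Measure X) : EReal :=
  sSup ((fun d : ℝ => (d : EReal)) '' {d : ℝ | IsLowerPhiBound Φ μ d})

/-- The (upper) Assouad dimension of a measure: the case `Φ = 0`. -/
def upperAssouadDim {X : Type*} [MetricSpace X] [MeasurableSpace X] (μ : Measure X) : EReal :=
  upperPhiDim (fun _ => 0) μ

/-- The lower Assouad dimension of a measure: the case `Φ = 0`. -/
def lowerAssouadDim {X : Type*} [MetricSpace X] [MeasurableSpace X] (μ : Measure X) : EReal :=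
  lowerPhiDim (fun _ => 0) μ

/-! ### Moran intervals and the Moran measure

Levels are indexed from `0`: the ratios `a n`, `b n` and the weights `p n`, `1 - p n` are used to
pass from step `n` to step `n + 1`. A Moran interval of step `n` is labelled by the first `n`
letters of a sequence `v : ℕ → Bool`, where `false` means left child and `true` right child. -/

/-- Length of the Moran interval of step `n` labelled by `v`. -/
def moranLength (a b : ℕ → ℝ) (v : ℕ → Bool) : ℕ → ℝ
  | 0 => 1
  | n + 1 => (if v n then b n else a n) * moranLength a b v n

/-- Left endpoint of the Moran interval of step `n` labelled by `v`: the left child keeps the left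
endpoint, the right child keeps the right endpoint. -/
def moranLeft (a b : ℕ → ℝ) (v : ℕ → Bool) : ℕ → ℝ
  | 0 => 0
  | n + 1 => moranLeft a b v n + if v n then (1 - b n) * moranLength a b v n else 0

/-- The Moran interval of step `n` labelled by the first `n` letters of `v`. -/
def moranInterval (a b : ℕ → ℝ) (v : ℕ → Bool) (n : ℕ) : Set ℝ :=
  Set.Icc (moranLeft a b v n) (moranLeft a b v n + moranLength a b v n)

/-- The point with address `v` of the Moran set: the common point of the nested intervals
`moranInterval a b v n`, `n : ℕ`, as the supremum of their left endpoints. -/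
def moranPoint (a b : ℕ → ℝ) (v : ℕ → Bool) : ℝ := ⨆ n, moranLeft a b v n

/-- The law on addresses: independent letters, the `n`-th one being left with probability `p n`
and right with probability `1 - p n`. -/
def addressMeasure (p : ℕ → unitInterval) : Measure (ℕ → Bool) :=
  Measure.infinitePi fun n => bernoulliMeasure false true (p n)

/-- The Moran measure: the image on the line of `addressMeasure p`. It is the Borel probability
measure determined by the rule that an interval of step `n` gives the fraction `p n` of its mass to
its left child and `1 - p n` to its right child; see `moranMeasure_left` and
`moranMeasure_right`. -/
def moranMeasure (a b : ℕ → ℝ) (p : ℕ → unitInterval) : Measure ℝ :=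
  (addressMeasure p).map (moranPoint a b)

/-- The admissible pairs of ratios, `{(x,y) ∈ [0,1]² : A ≤ min(x,y) < x + y ≤ B}`. -/
def ratioRegion (A B : ℝ) : Set (ℝ × ℝ) :=
  {z | z.1 ∈ Set.Icc 0 1 ∧ z.2 ∈ Set.Icc 0 1 ∧
    A ≤ min z.1 z.2 ∧ min z.1 z.2 < z.1 + z.2 ∧ z.1 + z.2 ≤ B}

/-! ### The almost sure values -/

/-- `max (log P₀ / log A₀, log Q₀ / log B₀)`, where `P₀ = ess inf p`, `Q₀ = ess inf (1 - p)`,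
`A₀ = ess sup a`, `B₀ = ess sup b`; it is `∞` if `P₀ = 0` or `Q₀ = 0`. -/
def moranAlpha {Ω : Type*} [MeasurableSpace Ω] (P : Measure Ω)
    (a b : Ω → ℝ) (p : Ω → unitInterval) : EReal :=
  let P₀ := essInf (fun ω => (p ω : ℝ)) P
  let Q₀ := essInf (fun ω => 1 - (p ω : ℝ)) P
  let A₀ := essSup a P
  let B₀ := essSup b P
  open Classical in
  if P₀ = 0 ∨ Q₀ = 0 then ⊤
  else ((max (Real.log P₀ / Real.log A₀) (Real.log Q₀ / Real.log B₀) : ℝ) : EReal)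

/-- `min (log p₀ / log a₀, log q₀ / log b₀)`, where `p₀ = ess sup p`, `q₀ = ess sup (1 - p)`,
`a₀ = ess inf a`, `b₀ = ess inf b`. -/
def moranBeta {Ω : Type*} [MeasurableSpace Ω] (P : Measure Ω)
    (a b : Ω → ℝ) (p : Ω → unitInterval) : ℝ :=
  let p₀ := essSup (fun ω => (p ω : ℝ)) P
  let q₀ := essSup (fun ω => 1 - (p ω : ℝ)) P
  let a₀ := essInf a P
  let b₀ := essInf b P
  min (Real.log p₀ / Real.log a₀) (Real.log q₀ / Real.log b₀)

/-! ### The measure satisfies its defining rule -/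

instance (p : ℕ → unitInterval) : IsProbabilityMeasure (addressMeasure p) := by
  unfold addressMeasure; infer_instance

theorem moranLength_congr (a b : ℕ → ℝ) {u v : ℕ → Bool} {n : ℕ} (h : ∀ i < n, u i = v i) :
    moranLength a b u n = moranLength a b v n := by
  induction n with
  | zero => rfl
  | succ n ih =>
    simp only [moranLength]
    rw [ih fun i hi => h i (by omega), h n (by omega)]

theorem moranLeft_congr (a b : ℕ → ℝ) {u v : ℕ → Bool} {n : ℕ} (h : ∀ i < n, u i = v i) :
    moranLeft a b u n = moranLeft a b v n := by
  induction n with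
  | zero => rfl
  | succ n ih =>
    simp only [moranLeft]
    rw [ih fun i hi => h i (by omega), h n (by omega),
      moranLength_congr a b fun i hi => h i (by omega)]

theorem measurable_moranPoint (a b : ℕ → ℝ) : Measurable (moranPoint a b) := by
  have hl : ∀ n, Measurable fun v : ℕ → Bool => moranLength a b v n := by
    intro n
    induction n with
    | zero => exact measurable_const
    | succ n ih =>
      simp only [moranLength]
      exact ((measurable_of_finite (fun c : Bool => if c then b n else a n)).comp
        (measurable_pi_apply n)).mul ih
  refine Measurable.iSup fun n => ?_
  induction n with
  | zero => exact measurable_const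
  | succ n ih =>
    simp only [moranLeft]
    refine ih.add (Measurable.ite ?_ ((hl n).const_mul _) measurable_const)
    exact (measurable_pi_apply (X := fun _ : ℕ => Bool) n) (measurableSet_singleton true)

instance (a b : ℕ → ℝ) (p : ℕ → unitInterval) : IsProbabilityMeasure (moranMeasure a b p) :=
  Measure.isProbabilityMeasure_map (measurable_moranPoint a b).aemeasurable

section Rule

variable {a b : ℕ → ℝ} {A B : ℝ}

theorem moranLength_pos (hA : 0 < A) (hab : ∀ n, (a n, b n) ∈ ratioRegion A B)
    (v : ℕ → Bool) (n : ℕ) : 0 < moranLength a b v n := by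
  induction n with
  | zero => exact one_pos
  | succ n ih =>
    have h := (hab n).2.2.1
    simp only [le_min_iff] at h
    simp only [moranLength]
    refine mul_pos ?_ ih
    split_ifs <;> linarith

theorem moranInterval_succ_subset (hA : 0 < A) (hB : B < 1)
    (hab : ∀ n, (a n, b n) ∈ ratioRegion A B) (v : ℕ → Bool) (n : ℕ) :
    moranLeft a b v n ≤ moranLeft a b v (n + 1) ∧
      moranLeft a b v (n + 1) + moranLength a b v (n + 1) ≤
        moranLeft a b v n + moranLength a b v n := by
  have hl := moranLength_pos hA hab v n
  obtain ⟨-, -, h, -, h'⟩ := hab n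
  simp only [le_min_iff] at h h'
  simp only [moranLeft, moranLength]
  cases v n
  · simp only [Bool.false_eq_true, if_false]
    constructor <;> nlinarith
  · simp only [if_true]
    constructor <;> nlinarith

theorem moranInterval_antitone (hA : 0 < A) (hB : B < 1)
    (hab : ∀ n, (a n, b n) ∈ ratioRegion A B) (v : ℕ → Bool) :
    Antitone (moranInterval a b v) :=
  antitone_nat_of_succ_le fun n =>
    Set.Icc_subset_Icc (moranInterval_succ_subset hA hB hab v n).1
      (moranInterval_succ_subset hA hB hab v n).2

theorem moranPoint_mem (hA : 0 < A) (hB : B < 1)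
    (hab : ∀ n, (a n, b n) ∈ ratioRegion A B) (v : ℕ → Bool) (n : ℕ) :
    moranPoint a b v ∈ moranInterval a b v n := by
  have hm : Monotone (moranLeft a b v) :=
    monotone_nat_of_le_succ fun n => (moranInterval_succ_subset hA hB hab v n).1
  have hup : ∀ m, moranLeft a b v m ≤ moranLeft a b v n + moranLength a b v n := by
    intro m
    have h1 : moranLeft a b v (max m n) ∈ moranInterval a b v (max m n) :=
      ⟨le_rfl, by linarith [moranLength_pos hA hab v (max m n)]⟩
    exact (hm (le_max_left m n)).trans
      (moranInterval_antitone hA hB hab v (le_max_right m n) h1).2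
  exact ⟨le_ciSup (f := moranLeft a b v) ⟨_, by rintro _ ⟨m, rfl⟩; exact hup m⟩ n, ciSup_le hup⟩

theorem moranPoint_mem_iff (hA : 0 < A) (hB : B < 1)
    (hab : ∀ n, (a n, b n) ∈ ratioRegion A B) (u v : ℕ → Bool) (n : ℕ) :
    moranPoint a b u ∈ moranInterval a b v n ↔ ∀ i < n, u i = v i := by
  refine ⟨fun h => ?_, fun h => ?_⟩
  · induction n with
    | zero => intro i hi; omega
    | succ n ih =>
      have hn := ih (moranInterval_antitone hA hB hab v (Nat.le_succ n) h)
      intro i hi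
      rcases Nat.lt_succ_iff_lt_or_eq.mp hi with hi | rfl
      · exact hn i hi
      have hu := moranPoint_mem hA hB hab u (i + 1)
      have hl := moranLength_pos hA hab v i
      obtain ⟨-, -, h3, -, h4⟩ := hab i
      simp only [le_min_iff] at h3 h4
      simp only [moranInterval, moranLeft, moranLength, Set.mem_Icc, moranLeft_congr a b hn,
        moranLength_congr a b hn] at h hu
      by_contra hne
      cases hui : u i <;> cases hvi : v i <;> simp [hui, hvi] at h hu hne <;> nlinarith
  · have := moranPoint_mem hA hB hab u n
    rwa [moranInterval, moranLeft_congr a b h, moranLength_congr a b h] at this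

/-- The mass of a Moran interval is the product of the weights along its label. -/
theorem moranMeasure_interval (hA : 0 < A) (hB : B < 1)
    (hab : ∀ n, (a n, b n) ∈ ratioRegion A B) (p : ℕ → unitInterval) (v : ℕ → Bool) (n : ℕ) :
    (moranMeasure a b p).real (moranInterval a b v n) =
      ∏ i ∈ Finset.range n, if v i then 1 - (p i : ℝ) else (p i : ℝ) := by
  have hpre : moranPoint a b ⁻¹' moranInterval a b v n =
      Set.pi (Finset.range n : Set ℕ) fun i => {v i} := by
    ext u
    simp [moranPoint_mem_iff hA hB hab, Set.mem_pi]
  have hI : MeasurableSet (moranInterval a b v n) := measurableSet_Icc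
  rw [measureReal_def, moranMeasure, Measure.map_apply (measurable_moranPoint a b) hI, hpre, addressMeasure, Measure.infinitePi_pi _ fun i _ =>
    measurableSet_singleton _, ENNReal.toReal_prod]
  refine Finset.prod_congr rfl fun i _ => ?_
  rw [← measureReal_def, bernoulliMeasure_real_apply _ (measurableSet_singleton _)]
  cases v i <;> simp

theorem moranMeasure_left (hA : 0 < A) (hB : B < 1)
    (hab : ∀ n, (a n, b n) ∈ ratioRegion A B) (p : ℕ → unitInterval) (v : ℕ → Bool) (n : ℕ)
    (hv : v n = false) :
    (moranMeasure a b p).real (moranInterval a b v (n + 1)) =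
      p n * (moranMeasure a b p).real (moranInterval a b v n) := by
  rw [moranMeasure_interval hA hB hab, moranMeasure_interval hA hB hab, Finset.prod_range_succ, hv]
  simp [mul_comm]

theorem moranMeasure_right (hA : 0 < A) (hB : B < 1)
    (hab : ∀ n, (a n, b n) ∈ ratioRegion A B) (p : ℕ → unitInterval) (v : ℕ → Bool) (n : ℕ)
    (hv : v n = true) :
    (moranMeasure a b p).real (moranInterval a b v (n + 1)) =
      (1 - p n) * (moranMeasure a b p).real (moranInterval a b v n) := by
  rw [moranMeasure_interval hA hB hab, moranMeasure_interval hA hB hab, Finset.prod_range_succ, hv]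
  simp [mul_comm]

end Rule

end

open Filter Topology

/-! Since `a n + b n ≤ B < 1`, the two children of an interval of length ℓ are at least (1 - B)ℓ
apart. Hence, up to bounded factors in the radius, balls around a point of the Moran set can be
replaced by the Moran intervals containing it (`moranMass_le_ball`, `ball_le_moranMass`), and both
dimensions compare products of weights with products of ratios along an address.

Let d ≥ 0. If ratio ^ d ≤ weight at every step and on each side, multiplication gives the upper
bound with exponent d (`isUpperPhiBound_of_rpow_le`). The worst case is the smallest weight together
with the largest ratio, and it allows exactly d ≥ α. The reversed inequality gives the lower bound,
exactly for d ≤ β (`isLowerPhiBound_of_le_rpow`).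

Conversely, independence and the second Borel–Cantelli lemma give, almost surely, arbitrarily long
and late runs of steps at which the ratio and the weight of one side are both near the relevant
extremes (`ae_exists_run_of_indep`). The address that always turns to this side passes through the
run: its length defeats any constant C₂, its lateness brings the scales below C₁
(`rpow_le_of_isUpperPhiBound`, `le_rpow_of_isLowerPhiBound`). Such an address sees one side only, so
the joint law of the two ratios does not enter. -/

/-! ### Ratios, weights and masses along an address -/

/-- The ratio used at step `i` by a left (`false`) or right (`true`) child. -/
def moranRatio (a b : ℕ → ℝ) (c : Bool) (i : ℕ) : ℝ := if c then b i else a i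

/-- The weight used at step `i` by a left (`false`) or right (`true`) child. -/
def moranWeight (p : ℕ → unitInterval) (c : Bool) (i : ℕ) : ℝ :=
  if c then 1 - (p i : ℝ) else (p i : ℝ)

/-- The mass of the Moran interval of step `n` labelled by `v`. -/
def moranMass (p : ℕ → unitInterval) (v : ℕ → Bool) (n : ℕ) : ℝ :=
  ∏ i ∈ Finset.range n, moranWeight p (v i) i

section Deterministic

variable {a b : ℕ → ℝ} {A B : ℝ} {p : ℕ → unitInterval} {v : ℕ → Bool}

theorem moranMeasure_interval_eq_mass (hA : 0 < A) (hB : B < 1)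
    (hab : ∀ n, (a n, b n) ∈ ratioRegion A B) (p : ℕ → unitInterval) (v : ℕ → Bool) (n : ℕ) :
    (moranMeasure a b p).real (moranInterval a b v n) = moranMass p v n :=
  moranMeasure_interval hA hB hab p v n

theorem moranLength_succ (a b : ℕ → ℝ) (v : ℕ → Bool) (n : ℕ) :
    moranLength a b v (n + 1) = moranRatio a b (v n) n * moranLength a b v n := rfl

theorem moranMass_succ (p : ℕ → unitInterval) (v : ℕ → Bool) (n : ℕ) :
    moranMass p v (n + 1) = moranWeight p (v n) n * moranMass p v n := by
  rw [moranMass, Finset.prod_range_succ, mul_comm]; rfl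

theorem moranRatio_mem (hab : ∀ n, (a n, b n) ∈ ratioRegion A B) (c : Bool) (n : ℕ) :
    A ≤ moranRatio a b c n ∧ moranRatio a b c n ≤ B := by
  obtain ⟨⟨h1, -⟩, ⟨h2, -⟩, h3, -, h4⟩ := hab n
  simp only [le_min_iff] at h1 h2 h3 h4
  cases c <;> simp only [moranRatio, if_true, Bool.false_eq_true, if_false] <;>
    constructor <;> linarith

theorem moranWeight_le_one (p : ℕ → unitInterval) (c : Bool) (n : ℕ) : moranWeight p c n ≤ 1 := by
  have h0 := (p n).2.1
  have h1 := (p n).2.2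
  cases c <;> simp [moranWeight, h0, h1]

theorem moranMass_pos (hp : ∀ c n, 0 < moranWeight p c n) (v : ℕ → Bool) (n : ℕ) :
    0 < moranMass p v n :=
  Finset.prod_pos fun _ _ => hp _ _

theorem moranMass_antitone (hp : ∀ c n, 0 < moranWeight p c n) (v : ℕ → Bool) :
    Antitone (moranMass p v) := by
  refine antitone_nat_of_succ_le fun n => ?_
  rw [moranMass_succ]
  exact mul_le_of_le_one_left (moranMass_pos hp v n).le (moranWeight_le_one p _ n)

theorem moranLength_antitone (hA : 0 < A) (hB : B < 1)
    (hab : ∀ n, (a n, b n) ∈ ratioRegion A B) (v : ℕ → Bool) :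
    Antitone (moranLength a b v) := by
  refine antitone_nat_of_succ_le fun n => ?_
  rw [moranLength_succ]
  exact mul_le_of_le_one_left (moranLength_pos hA hab v n).le
    ((moranRatio_mem hab _ n).2.trans hB.le)

theorem mul_moranLength_le (hA : 0 < A)
    (hab : ∀ n, (a n, b n) ∈ ratioRegion A B) (v : ℕ → Bool) (n : ℕ) :
    A * moranLength a b v n ≤ moranLength a b v (n + 1) := by
  rw [moranLength_succ]
  exact mul_le_mul_of_nonneg_right (moranRatio_mem hab _ n).1 (moranLength_pos hA hab v n).le

/-- A run of `k` indices along which the ratios are at most `t`. -/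
theorem moranLength_add_le (hA : 0 < A) (hab : ∀ n, (a n, b n) ∈ ratioRegion A B)
    {t : ℝ} {n k : ℕ}
    (h : ∀ i < k, moranRatio a b (v (n + i)) (n + i) ≤ t) :
    moranLength a b v (n + k) ≤ t ^ k * moranLength a b v n := by
  induction k with
  | zero => simp
  | succ k ih =>
    have hk := h k (by omega)
    have ht : 0 ≤ t := (hA.le.trans (moranRatio_mem hab _ _).1).trans hk
    rw [← add_assoc, moranLength_succ, pow_succ', mul_assoc]
    exact mul_le_mul hk (ih fun i hi => h i (by omega)) (moranLength_pos hA hab v _).le ht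

theorem le_moranLength_add (hA : 0 < A) (hab : ∀ n, (a n, b n) ∈ ratioRegion A B)
    {t : ℝ} (ht : 0 ≤ t) {n k : ℕ}
    (h : ∀ i < k, t ≤ moranRatio a b (v (n + i)) (n + i)) :
    t ^ k * moranLength a b v n ≤ moranLength a b v (n + k) := by
  induction k with
  | zero => simp
  | succ k ih =>
    have hk := h k (by omega)
    rw [← add_assoc, moranLength_succ, pow_succ', mul_assoc]
    exact mul_le_mul hk (ih fun i hi => h i (by omega))
      (mul_nonneg (pow_nonneg ht _) (moranLength_pos hA hab v _).le) (ht.trans hk)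

theorem moranMass_add_le (hp : ∀ c n, 0 < moranWeight p c n) {s : ℝ} {n k : ℕ}
    (h : ∀ i < k, moranWeight p (v (n + i)) (n + i) ≤ s) :
    moranMass p v (n + k) ≤ s ^ k * moranMass p v n := by
  induction k with
  | zero => simp
  | succ k ih =>
    have hk := h k (by omega)
    rw [← add_assoc, moranMass_succ, pow_succ', mul_assoc]
    exact mul_le_mul hk (ih fun i hi => h i (by omega)) (moranMass_pos hp v _).le
      ((hp _ _).le.trans hk)

theorem le_moranMass_add (hp : ∀ c n, 0 < moranWeight p c n) {s : ℝ} (hs : 0 ≤ s) {n k : ℕ}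
    (h : ∀ i < k, s ≤ moranWeight p (v (n + i)) (n + i)) :
    s ^ k * moranMass p v n ≤ moranMass p v (n + k) := by
  induction k with
  | zero => simp
  | succ k ih =>
    have hk := h k (by omega)
    rw [← add_assoc, moranMass_succ, pow_succ', mul_assoc]
    exact mul_le_mul hk (ih fun i hi => h i (by omega))
      (mul_nonneg (pow_nonneg hs _) (moranMass_pos hp v _).le) (hs.trans hk)

theorem moranLength_add_le_pow (hA : 0 < A) (hab : ∀ n, (a n, b n) ∈ ratioRegion A B)
    (v : ℕ → Bool) (n k : ℕ) : moranLength a b v (n + k) ≤ B ^ k * moranLength a b v n :=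
  moranLength_add_le hA hab fun _ _ => (moranRatio_mem hab _ _).2

theorem moranLength_le_pow (hA : 0 < A) (hab : ∀ n, (a n, b n) ∈ ratioRegion A B)
    (v : ℕ → Bool) (n : ℕ) : moranLength a b v n ≤ B ^ n := by
  simpa [moranLength] using moranLength_add_le_pow hA hab v 0 n

/-- Every scale in `(0, 1]` lies between two consecutive lengths along an address. -/
theorem exists_moranLength_lt_le (hA : 0 < A) (hB : B < 1)
    (hab : ∀ n, (a n, b n) ∈ ratioRegion A B)
    (v : ℕ → Bool) {r : ℝ} (hr : 0 < r) (hr1 : r ≤ 1) :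
    ∃ n, moranLength a b v (n + 1) < r ∧ r ≤ moranLength a b v n := by
  classical
  have hex : ∃ n, moranLength a b v n < r := by
    obtain ⟨n, hn⟩ := exists_pow_lt_of_lt_one hr hB
    exact ⟨n, (moranLength_le_pow hA hab v n).trans_lt hn⟩
  have hpos : Nat.find hex ≠ 0 := by
    intro h
    have := Nat.find_spec hex
    rw [h] at this
    simp only [moranLength] at this
    linarith
  obtain ⟨m, hm⟩ := Nat.exists_eq_succ_of_ne_zero hpos
  refine ⟨m, ?_, ?_⟩
  · have := Nat.find_spec hex
    rwa [hm] at this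
  · exact not_lt.mp (Nat.find_min hex (by omega))

/-! ### Balls and Moran intervals -/

theorem abs_moranPoint_sub_le (hA : 0 < A) (hB : B < 1)
    (hab : ∀ n, (a n, b n) ∈ ratioRegion A B) {x : ℝ} {n : ℕ}
    (h : x ∈ moranInterval a b v n) :
    |x - moranPoint a b v| ≤ moranLength a b v n := by
  have h2 := moranPoint_mem hA hB hab v n
  rw [moranInterval, Set.mem_Icc] at h h2
  rw [abs_le]; constructor <;> linarith

/-- The two points lie in different children of the same interval of step `n`, and the gap between
these children is 1 - a - b times its length. -/
theorem le_abs_moranPoint_sub (hA : 0 < A) (hB : B < 1)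
    (hab : ∀ n, (a n, b n) ∈ ratioRegion A B) {u v : ℕ → Bool} {n : ℕ}
    (h : ∀ i < n, u i = v i) (hne : u n ≠ v n) :
    (1 - B) * moranLength a b v n ≤ |moranPoint a b u - moranPoint a b v| := by
  have hu := moranPoint_mem hA hB hab u (n + 1)
  have hv := moranPoint_mem hA hB hab v (n + 1)
  have hl := moranLength_pos hA hab v n
  obtain ⟨-, -, -, -, h4⟩ := hab n
  simp only at h4
  have h5 := mul_le_mul_of_nonneg_right h4 hl.le
  simp only [moranInterval, moranLeft, moranLength, Set.mem_Icc, moranLeft_congr a b h,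
    moranLength_congr a b h] at hu hv
  cases hui : u n <;> cases hvi : v n <;> simp [hui, hvi] at hu hv hne
  · rw [abs_sub_comm]; refine le_trans ?_ (le_abs_self _); linarith
  · refine le_trans ?_ (le_abs_self _); linarith

theorem moranMass_le_ball (hA : 0 < A) (hB : B < 1)
    (hab : ∀ n, (a n, b n) ∈ ratioRegion A B) (p : ℕ → unitInterval) {n : ℕ} {r : ℝ}
    (h : moranLength a b v n < r) :
    moranMass p v n ≤ (moranMeasure a b p).real (Metric.ball (moranPoint a b v) r) := by
  rw [← moranMeasure_interval_eq_mass hA hB hab]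
  refine measureReal_mono fun x hx => ?_
  rw [Metric.mem_ball, Real.dist_eq]
  exact (abs_moranPoint_sub_le hA hB hab hx).trans_lt h

/-- An address that leaves `v` at an index ≤ n has its point outside the ball, by the gap. The
comparison is made between preimages in the space of addresses, since the ball itself need not lie
in the interval. -/
theorem ball_le_moranMass (hA : 0 < A) (hB : B < 1)
    (hab : ∀ n, (a n, b n) ∈ ratioRegion A B) (p : ℕ → unitInterval) {n : ℕ} {r : ℝ}
    (h : r ≤ (1 - B) * moranLength a b v n) :
    (moranMeasure a b p).real (Metric.ball (moranPoint a b v) r) ≤ moranMass p v (n + 1) := by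
  classical
  have hm := measurable_moranPoint a b
  rw [← moranMeasure_interval_eq_mass hA hB hab, moranMeasure,
    map_measureReal_apply hm Metric.isOpen_ball.measurableSet, moranInterval,
    map_measureReal_apply hm measurableSet_Icc, ← moranInterval]
  refine measureReal_mono fun u hu => ?_
  rw [Set.mem_preimage, moranPoint_mem_iff hA hB hab]
  by_contra hne
  push Not at hne
  obtain ⟨h1, h2⟩ := Nat.find_spec hne
  have h3 := le_abs_moranPoint_sub hA hB hab (u := u) (v := v) (n := Nat.find hne)
    (fun i hi => by
      have := Nat.find_min hne hi
      push Not at this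
      exact this (by omega)) h2
  have h4 := moranLength_antitone hA hB hab v (show Nat.find hne ≤ n by omega)
  have h5 := mul_le_mul_of_nonneg_left h4 (by linarith : 0 ≤ 1 - B)
  rw [Set.mem_preimage, Metric.mem_ball, Real.dist_eq] at hu
  linarith

theorem continuous_moranPoint (hA : 0 < A) (hB : B < 1)
    (hab : ∀ n, (a n, b n) ∈ ratioRegion A B) : Continuous (moranPoint a b) := by
  rw [continuous_iff_continuousAt]
  intro v
  rw [ContinuousAt, Metric.tendsto_nhds]
  intro ε hε
  obtain ⟨n, hn⟩ := exists_pow_lt_of_lt_one hε hB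
  have hopen : ∀ᶠ u in 𝓝 v, ∀ i ∈ Finset.range n, u i = v i := by
    rw [Filter.eventually_all_finset]
    intro i _
    have : Tendsto (fun u : ℕ → Bool => u i) (𝓝 v) (𝓝 (v i)) := (continuous_apply i).tendsto v
    rw [nhds_discrete Bool] at this
    simpa using this
  filter_upwards [hopen] with u hu
  rw [Real.dist_eq]
  have : moranPoint a b u ∈ moranInterval a b v n :=
    (moranPoint_mem_iff hA hB hab u v n).2 fun i hi => hu i (Finset.mem_range.2 hi)
  exact ((abs_moranPoint_sub_le hA hB hab this).trans (moranLength_le_pow hA hab v n)).trans_lt hn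

/-- The set of Moran points is a continuous image of a compact space, hence closed, and it carries
all the mass. -/
theorem exists_moranPoint_of_mem_support (hA : 0 < A) (hB : B < 1)
    (hab : ∀ n, (a n, b n) ∈ ratioRegion A B) (p : ℕ → unitInterval) {x : ℝ}
    (hx : x ∈ (moranMeasure a b p).support) : ∃ v, moranPoint a b v = x := by
  have hc : IsClosed (Set.range (moranPoint a b)) :=
    (isCompact_range (continuous_moranPoint hA hB hab)).isClosed
  by_contra hne
  have h1 : (Set.range (moranPoint a b))ᶜ ∈ 𝓝 x := hc.isOpen_compl.mem_nhds hne
  rw [Measure.mem_support_iff_forall] at hx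
  have h2 := hx _ h1
  rw [moranMeasure, Measure.map_apply (measurable_moranPoint a b) hc.measurableSet.compl] at h2
  have : moranPoint a b ⁻¹' (Set.range (moranPoint a b))ᶜ = ∅ := by
    ext u; simp
  simp [this] at h2

theorem moranPoint_mem_support (hA : 0 < A) (hB : B < 1)
    (hab : ∀ n, (a n, b n) ∈ ratioRegion A B) (hp : ∀ c n, 0 < moranWeight p c n)
    (v : ℕ → Bool) : moranPoint a b v ∈ (moranMeasure a b p).support := by
  rw [Measure.mem_support_iff_forall]
  intro U hU
  obtain ⟨ε, hε, hU⟩ := Metric.mem_nhds_iff.1 hU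
  obtain ⟨n, hn⟩ := exists_pow_lt_of_lt_one hε hB
  have h1 := (moranMass_pos hp v n).trans_le
    (moranMass_le_ball hA hB hab p ((moranLength_le_pow hA hab v n).trans_lt hn))
  exact (ENNReal.toReal_pos_iff.1 h1).1.trans_le (measure_mono hU)

/-! ### Deterministic bounds -/

/-- Product of the one-step inequalities over the indices from `m` to `n - 1`, kept free of
division. -/
theorem moranMass_mul_rpow_le (hA : 0 < A) (hab : ∀ n, (a n, b n) ∈ ratioRegion A B)
    (hp : ∀ c n, 0 < moranWeight p c n) {d : ℝ}
    (h : ∀ c n, moranRatio a b c n ^ d ≤ moranWeight p c n) {m n : ℕ} (hmn : m ≤ n) :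
    moranLength a b v n ^ d * moranMass p v m ≤ moranMass p v n * moranLength a b v m ^ d := by
  induction n, hmn using Nat.le_induction with
  | base => rw [mul_comm]
  | succ n hmn ih =>
    have hq : 0 < moranRatio a b (v n) n := hA.trans_le (moranRatio_mem hab _ n).1
    have hl := moranLength_pos hA hab v n
    rw [moranLength_succ, moranMass_succ, Real.mul_rpow hq.le hl.le, mul_assoc, mul_assoc]
    exact mul_le_mul (h _ _) ih
      (mul_nonneg (Real.rpow_nonneg hl.le _) (moranMass_pos hp v m).le) (hp _ _).le

theorem le_moranMass_mul_rpow (hA : 0 < A) (hab : ∀ n, (a n, b n) ∈ ratioRegion A B)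
    (hp : ∀ c n, 0 < moranWeight p c n) {d : ℝ}
    (h : ∀ c n, moranWeight p c n ≤ moranRatio a b c n ^ d) {m n : ℕ} (hmn : m ≤ n) :
    moranMass p v n * moranLength a b v m ^ d ≤ moranLength a b v n ^ d * moranMass p v m := by
  induction n, hmn using Nat.le_induction with
  | base => rw [mul_comm]
  | succ n hmn ih =>
    have hq : 0 < moranRatio a b (v n) n := hA.trans_le (moranRatio_mem hab _ n).1
    have hl := moranLength_pos hA hab v n
    rw [moranLength_succ, moranMass_succ, Real.mul_rpow hq.le hl.le, mul_assoc, mul_assoc]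
    exact mul_le_mul (h _ _) ih
      (mul_nonneg (moranMass_pos hp v n).le (Real.rpow_nonneg (moranLength_pos hA hab v m).le _))
      (Real.rpow_nonneg hq.le _)

theorem isUpperPhiBound_of_rpow_le (hA : 0 < A) (hAB : A < B) (hB : B < 1)
    (hab : ∀ n, (a n, b n) ∈ ratioRegion A B) (hp : ∀ c n, 0 < moranWeight p c n)
    {d : ℝ} (hd : 0 ≤ d) (h : ∀ c n, moranRatio a b c n ^ d ≤ moranWeight p c n) :
    IsUpperPhiBound (fun _ => 0) (moranMeasure a b p) d := by
  have hB' : 0 < 1 - B := by linarith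
  -- In the constant, 1 - B is the cost of the gap and `A` the cost of rounding a radius to a
  -- length. `R ≤ 1 - B` keeps the enlarged scale `R / (1 - B)` at most 1.
  refine ⟨1 - B, hB', (1 / ((1 - B) * A)) ^ d, by positivity, ?_⟩
  intro r R hr hrR _ hR _ x hx
  simp only [add_zero, Real.rpow_one] at hrR
  have hR0 : 0 < R := hr.trans hrR
  obtain ⟨v, rfl⟩ := exists_moranPoint_of_mem_support hA hB hab p hx
  obtain ⟨N, hN1, hN2⟩ := exists_moranLength_lt_le hA hB hab v (div_pos hR0 hB')
    ((div_le_one hB').2 hR)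
  obtain ⟨n, hn1, hn2⟩ := exists_moranLength_lt_le hA hB hab v hr (by linarith)
  rw [div_le_iff₀' hB'] at hN2
  -- Otherwise ℓ_N ≤ ℓ_{n+1} < r < R ≤ (1 - B)ℓ_N, where ℓ_j is the length at step j.
  have hNn : N ≤ n := by
    by_contra hlt
    have h1 := moranLength_antitone hA hB hab v (show n + 1 ≤ N by omega)
    have h2 := moranLength_pos hA hab v N
    nlinarith
  have hn3 := mul_moranLength_le hA hab v n
  have hM := moranMass_mul_rpow_le (v := v) hA hab hp h (Nat.succ_le_succ hNn)
  have hpn := moranMass_pos hp v (n + 1)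
  have hln := moranLength_pos hA hab v (n + 1)
  have hlN := moranLength_pos hA hab v (N + 1)
  have hpN := moranMass_pos hp v (N + 1)
  calc _ ≤ moranMass p v (N + 1) / moranMass p v (n + 1) :=
        div_le_div₀ hpN.le (ball_le_moranMass hA hB hab p hN2) hpn
          (moranMass_le_ball hA hB hab p hn1)
    _ ≤ (moranLength a b v (N + 1) / moranLength a b v (n + 1)) ^ d := by
        rw [Real.div_rpow hlN.le hln.le, div_le_div_iff₀ hpn (Real.rpow_pos_of_pos hln _)]
        linarith
    _ ≤ (1 / ((1 - B) * A) * (R / r)) ^ d := by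
        refine Real.rpow_le_rpow (by positivity) ?_ hd
        calc _ ≤ (R / (1 - B)) / (A * r) :=
              div_le_div₀ (by positivity) hN1.le (by positivity)
                ((mul_le_mul_of_nonneg_left hn2 hA.le).trans hn3)
          _ = _ := by field_simp
    _ = _ := Real.mul_rpow (by positivity) (by positivity)

theorem isLowerPhiBound_of_le_rpow (hA : 0 < A) (hAB : A < B) (hB : B < 1)
    (hab : ∀ n, (a n, b n) ∈ ratioRegion A B) (hp : ∀ c n, 0 < moranWeight p c n)
    {d : ℝ} (hd : 0 ≤ d) (h : ∀ c n, moranWeight p c n ≤ moranRatio a b c n ^ d) :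
    IsLowerPhiBound (fun _ => 0) (moranMeasure a b p) d := by
  have hB' : 0 < 1 - B := by linarith
  refine ⟨1 - B, hB', ((1 - B) * A) ^ d, by positivity, ?_⟩
  intro r R hr hrR _ hR _ x hx
  simp only [add_zero, Real.rpow_one] at hrR
  have hR0 : 0 < R := hr.trans hrR
  obtain ⟨v, rfl⟩ := exists_moranPoint_of_mem_support hA hB hab p hx
  obtain ⟨N, hN1, hN2⟩ := exists_moranLength_lt_le hA hB hab v hR0 (by linarith)
  obtain ⟨n, hn1, hn2⟩ := exists_moranLength_lt_le hA hB hab v (div_pos hr hB')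
    ((div_le_one hB').2 (by linarith))
  rw [div_le_iff₀' hB'] at hn2
  have hN3 := mul_moranLength_le hA hab v N
  have hpn := moranMass_pos hp v (n + 1)
  have hln := moranLength_pos hA hab v (n + 1)
  have hlN := moranLength_pos hA hab v (N + 1)
  have hpN := moranMass_pos hp v (N + 1)
  obtain ⟨j, hj⟩ : ∃ j, moranLength a b v (j + 1) < r := by
    obtain ⟨j, hj, -⟩ := exists_moranLength_lt_le hA hB hab v hr (by linarith)
    exact ⟨j, hj⟩
  have hball : 0 < (moranMeasure a b p).real (Metric.ball (moranPoint a b v) r) :=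
    (moranMass_pos hp v _).trans_le (moranMass_le_ball hA hB hab p hj)
  rw [← Real.mul_rpow (by positivity) (by positivity)]
  -- The gap factor now enlarges the small radius, so the order of `N` and `n` may be reversed. In
  -- that case `R / r` is bounded by 1 / (1 - B), and it is enough that the larger ball has the
  -- larger mass.
  rcases le_or_gt N n with hNn | hnN
  · have hM := le_moranMass_mul_rpow (v := v) hA hab hp h (Nat.succ_le_succ hNn)
    calc _ ≤ (moranLength a b v (N + 1) / moranLength a b v (n + 1)) ^ d := by
          refine Real.rpow_le_rpow (by positivity) ?_ hd
          calc _ = (A * R) / (r / (1 - B)) := by field_simp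
            _ ≤ _ := div_le_div₀ hlN.le ((mul_le_mul_of_nonneg_left hN2 hA.le).trans hN3)
                hln hn1.le
      _ ≤ moranMass p v (N + 1) / moranMass p v (n + 1) := by
          rw [Real.div_rpow hlN.le hln.le, div_le_div_iff₀ (Real.rpow_pos_of_pos hln _) hpn]
          linarith
      _ ≤ _ := div_le_div₀ measureReal_nonneg (moranMass_le_ball hA hB hab p hN1) hball
          (ball_le_moranMass hA hB hab p hn2)
  · have h1 : (1 - B) * A * (R / r) ≤ 1 := by
      have h2 := moranLength_antitone hA hB hab v (show n + 1 ≤ N by omega)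
      have h3 : R < r / (1 - B) := by linarith
      rw [lt_div_iff₀ hB'] at h3
      rw [← mul_div_assoc, div_le_one hr]
      nlinarith [mul_pos hB' hR0]
    calc _ ≤ (1 : ℝ) := Real.rpow_le_one (by positivity) h1 hd
      _ ≤ _ := by
        rw [one_le_div hball]
        exact measureReal_mono (Metric.ball_subset_ball hrR.le)

/-! ### Sharpness along runs -/

/-- A positive constant cannot stay below `C * θ ^ k` for all `k` when `θ < 1`. -/
theorem exists_mul_pow_lt {C ε θ : ℝ} (hε : 0 < ε) (h0 : 0 ≤ θ) (h1 : θ < 1) (K : ℕ) :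
    ∃ k ≥ K, C * θ ^ k < ε := by
  have h : Tendsto (fun k : ℕ => C * θ ^ k) atTop (𝓝 (C * 0)) :=
    (tendsto_pow_atTop_nhds_zero_of_lt_one h0 h1).const_mul C
  rw [mul_zero] at h
  obtain ⟨k, hk, hk'⟩ := ((h.eventually_lt_const hε).and (eventually_ge_atTop K)).exists
  exact ⟨k, hk', hk⟩

/-- Across a run of length k, at the point whose letters are all `c`, the mass ratio is at least
s^(-k), while the scale ratio is at most a constant times t^(-k). If s < t^d, this contradicts the
bound for large k. -/
theorem rpow_le_of_isUpperPhiBound (hA : 0 < A) (hAB : A < B) (hB : B < 1)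
    (hab : ∀ n, (a n, b n) ∈ ratioRegion A B) (hp : ∀ c n, 0 < moranWeight p c n)
    {d : ℝ} (hd : 0 ≤ d) (h : IsUpperPhiBound (fun _ => 0) (moranMeasure a b p) d)
    {c : Bool} {s t : ℝ} (hs : 0 < s) (ht : 0 < t)
    (hrun : ∀ k N : ℕ, ∃ n ≥ N, ∀ i < k,
      moranWeight p c (n + i) ≤ s ∧ t ≤ moranRatio a b c (n + i)) :
    t ^ d ≤ s := by
  by_contra hlt
  push Not at hlt
  obtain ⟨C₁, hC₁, C₂, hC₂, h⟩ := h
  have hB' : 0 < 1 - B := by linarith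
  have htd : 0 < t ^ d := Real.rpow_pos_of_pos ht d
  -- The run length depends on `C₂` alone and is fixed before the position of the run. The starting
  -- index is then made large in terms of `C₁`.
  obtain ⟨k, -, hk⟩ := exists_mul_pow_lt (C := C₂ * (2 / (1 - B)) ^ d) one_pos
    (div_nonneg hs.le htd.le) ((div_lt_one htd).2 hlt) 0
  obtain ⟨N, -, hN⟩ := exists_mul_pow_lt (C := 2) (lt_min hC₁ one_pos) (hA.trans hAB).le hB 0
  obtain ⟨n, hnN, hn⟩ := hrun k N
  let v : ℕ → Bool := fun _ => c
  have hln := moranLength_pos hA hab v n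
  have hlk := moranLength_pos hA hab v (n + k)
  have hpn := moranMass_pos hp v n
  have hpk := moranMass_pos hp v (n + k)
  have hlen : 2 * moranLength a b v n < min C₁ 1 := by
    have h1 := moranLength_le_pow hA hab v n
    have h2 := pow_le_pow_of_le_one (hA.trans hAB).le hB.le hnN
    linarith
  have hanti := moranLength_antitone hA hB hab v (Nat.le_add_right n k)
  have hmass := moranMass_add_le (v := v) hp fun i hi => (hn i hi).1
  have hleng := le_moranLength_add (v := v) hA hab ht.le fun i hi => (hn i hi).2
  have hrR : (1 - B) * moranLength a b v (n + k) < 2 * moranLength a b v n := by nlinarith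
  -- The factor 2 makes the open ball contain the whole interval of step `n`; the factor 1 - B keeps
  -- the small ball's mass within the interval of step `n + k`.
  have key := h ((1 - B) * moranLength a b v (n + k)) (2 * moranLength a b v n)
    (by positivity) (by simpa using hrR) (by simp) (hlen.le.trans (min_le_left _ _))
    (hlen.trans_le (min_le_right _ _)) _ (moranPoint_mem_support hA hB hab hp v)
  have hsmall : 0 < (moranMeasure a b p).real (Metric.ball (moranPoint a b v)
      ((1 - B) * moranLength a b v (n + k))) := by
    obtain ⟨j, hj, -⟩ := exists_moranLength_lt_le hA hB hab v
      (r := (1 - B) * moranLength a b v (n + k)) (by positivity)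
      (by linarith [min_le_right C₁ 1])
    exact (moranMass_pos hp v _).trans_le (moranMass_le_ball hA hB hab p hj)
  have h1 : (s ^ k)⁻¹ ≤ C₂ * (2 / (1 - B) * (t ^ k)⁻¹) ^ d := by
    calc _ ≤ moranMass p v n / moranMass p v (n + k) := by
          rw [le_div_iff₀ hpk, inv_mul_le_iff₀ (by positivity)]; exact hmass
      _ ≤ _ := div_le_div₀ measureReal_nonneg
          (moranMass_le_ball hA hB hab p (by linarith)) hsmall
          ((ball_le_moranMass hA hB hab p le_rfl).trans
            (moranMass_antitone hp v (Nat.le_succ _)))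
      _ ≤ _ := key
      _ ≤ _ := by
          refine mul_le_mul_of_nonneg_left (Real.rpow_le_rpow (by positivity) ?_ hd) hC₂.le
          rw [div_mul_eq_mul_div, ← div_eq_mul_inv, div_div,
            div_le_div_iff₀ (by positivity) (by positivity)]
          nlinarith [mul_le_mul_of_nonneg_left hleng hB'.le]
  rw [Real.mul_rpow (by positivity) (by positivity), Real.inv_rpow (by positivity),
    ← Real.rpow_natCast t k, ← Real.rpow_mul ht.le, mul_comm (k : ℝ) d, Real.rpow_mul ht.le,
    Real.rpow_natCast, inv_le_iff_one_le_mul₀ (by positivity)] at h1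
  rw [div_pow, ← mul_div_assoc, div_lt_one (by positivity)] at hk
  rw [← mul_assoc, mul_assoc, inv_mul_eq_div, ← mul_div_assoc, le_div_iff₀ (by positivity)] at h1
  linarith

theorem le_rpow_of_isLowerPhiBound (hA : 0 < A) (hAB : A < B) (hB : B < 1)
    (hab : ∀ n, (a n, b n) ∈ ratioRegion A B) (hp : ∀ c n, 0 < moranWeight p c n)
    {d : ℝ} (hd : 0 ≤ d) (h : IsLowerPhiBound (fun _ => 0) (moranMeasure a b p) d)
    {c : Bool} {s t : ℝ} (hs : 0 < s) (ht : 0 < t)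
    (hrun : ∀ k N : ℕ, ∃ n ≥ N, ∀ i < k,
      s ≤ moranWeight p c (n + i) ∧ moranRatio a b c (n + i) ≤ t) :
    s ≤ t ^ d := by
  by_contra hlt
  push Not at hlt
  obtain ⟨C₁, hC₁, C₂, hC₂, h⟩ := h
  have hB' : 0 < 1 - B := by linarith
  have htd : 0 < t ^ d := Real.rpow_pos_of_pos ht d
  have hB0 : 0 < B := hA.trans hAB
  -- The radii will be 2ℓ_{n+k} and (1 - B)ℓ_n, with the factors exchanged; a run of length at least
  -- `K` guarantees that the first is the smaller one.
  obtain ⟨K, -, hK⟩ := exists_mul_pow_lt (C := 2) hB' hB0.le hB 0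
  obtain ⟨k, hKk, hk⟩ := exists_mul_pow_lt (C := 1)
    (show 0 < C₂ * ((1 - B) / 2) ^ d by positivity)
    (div_nonneg htd.le hs.le) ((div_lt_one hs).2 hlt) K
  obtain ⟨N, -, hN⟩ := exists_mul_pow_lt (C := 1) (lt_min hC₁ one_pos) hB0.le hB 0
  obtain ⟨n, hnN, hn⟩ := hrun k N
  let v : ℕ → Bool := fun _ => c
  have hln := moranLength_pos hA hab v n
  have hlk := moranLength_pos hA hab v (n + k)
  have hpn := moranMass_pos hp v n
  have hpk := moranMass_pos hp v (n + k)
  have hlen : moranLength a b v n < min C₁ 1 := by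
    have h1 := moranLength_le_pow hA hab v n
    have h2 := pow_le_pow_of_le_one hB0.le hB.le hnN
    linarith
  have hlen' : (1 - B) * moranLength a b v n < min C₁ 1 := by nlinarith
  have hmass := le_moranMass_add (v := v) hp hs.le fun i hi => (hn i hi).1
  have hleng := moranLength_add_le (v := v) hA hab fun i hi => (hn i hi).2
  have hrR : 2 * moranLength a b v (n + k) < (1 - B) * moranLength a b v n := by
    have h1 := moranLength_add_le_pow hA hab v n k
    have h2 := pow_le_pow_of_le_one hB0.le hB.le hKk
    nlinarith
  have key := h (2 * moranLength a b v (n + k)) ((1 - B) * moranLength a b v n)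
    (by positivity) (by simpa using hrR) (by simp) (hlen'.le.trans (min_le_left _ _))
    (hlen'.trans_le (min_le_right _ _)) _ (moranPoint_mem_support hA hB hab hp v)
  have h1 : C₂ * ((1 - B) / 2 * (t ^ k)⁻¹) ^ d ≤ (s ^ k)⁻¹ := by
    calc _ ≤ _ := by
          refine mul_le_mul_of_nonneg_left (Real.rpow_le_rpow (by positivity) ?_ hd) hC₂.le
          show _ ≤ (1 - B) * moranLength a b v n / (2 * moranLength a b v (n + k))
          rw [div_mul_eq_mul_div, ← div_eq_mul_inv, div_div,
            div_le_div_iff₀ (by positivity) (by positivity)]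
          nlinarith [mul_le_mul_of_nonneg_left hleng hB'.le]
      _ ≤ _ := key
      _ ≤ moranMass p v n / moranMass p v (n + k) :=
          div_le_div₀ hpn.le ((ball_le_moranMass hA hB hab p le_rfl).trans
            (moranMass_antitone hp v (Nat.le_succ _))) hpk
            (moranMass_le_ball hA hB hab p (by linarith))
      _ ≤ _ := by
          rw [div_le_iff₀ hpk, le_inv_mul_iff₀ (by positivity)]; exact hmass
  rw [Real.mul_rpow (by positivity) (by positivity), Real.inv_rpow (by positivity),
    ← Real.rpow_natCast t k, ← Real.rpow_mul ht.le, mul_comm (k : ℝ) d, Real.rpow_mul ht.le,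
    Real.rpow_natCast] at h1
  rw [one_mul, div_pow, div_lt_iff₀ (by positivity)] at hk
  rw [← mul_assoc, ← div_eq_mul_inv, div_le_iff₀ (by positivity), inv_mul_eq_div,
    le_div_iff₀ (by positivity)] at h1
  linarith

end Deterministic
/-! ### Almost sure values from extremal runs -/

section Values

variable {a b : ℕ → ℝ} {A B : ℝ} {p : ℕ → unitInterval}

theorem IsUpperPhiBound.mono {μ : Measure ℝ} {d d' : ℝ} (h : IsUpperPhiBound (fun _ => 0) μ d)
    (hd : d ≤ d') : IsUpperPhiBound (fun _ => 0) μ d' := by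
  obtain ⟨C₁, hC₁, C₂, hC₂, h⟩ := h
  refine ⟨C₁, hC₁, C₂, hC₂, fun r R hr hrR h1 h2 h3 x hx => (h r R hr hrR h1 h2 h3 x hx).trans ?_⟩
  simp only [add_zero, Real.rpow_one] at hrR
  exact mul_le_mul_of_nonneg_left
    (Real.rpow_le_rpow_of_exponent_le ((one_le_div hr).2 hrR.le) hd) hC₂.le

/-- For positive `s c`, the condition t^d ≤ s means d ≥ log s / log t, because log t < 0. It
suffices for the bound since ratio^d ≤ t^d ≤ s ≤ weight, and the runs make it necessary. -/
theorem upperAssouadDim_moranMeasure (hA : 0 < A) (hAB : A < B) (hB : B < 1)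
    (hab : ∀ n, (a n, b n) ∈ ratioRegion A B) (hp : ∀ c n, 0 < moranWeight p c n)
    {s t : Bool → ℝ} (hs : ∀ c n, s c ≤ moranWeight p c n) (hs0 : ∀ c, 0 ≤ s c)
    (ht : ∀ c n, moranRatio a b c n ≤ t c) (htB : ∀ c, t c ≤ B)
    (hrun : ∀ c (m k N : ℕ), ∃ n ≥ N, ∀ i < k,
      moranWeight p c (n + i) ≤ s c + 1 / ((m : ℝ) + 1) ∧
        t c - 1 / ((m : ℝ) + 1) ≤ moranRatio a b c (n + i)) :
    upperAssouadDim (moranMeasure a b p) =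
      open Classical in
      if s false = 0 ∨ s true = 0 then ⊤
      else ((max (Real.log (s false) / Real.log (t false))
        (Real.log (s true) / Real.log (t true)) : ℝ) : EReal) := by
  have ht0 : ∀ c, 0 < t c := fun c =>
    hA.trans_le ((moranRatio_mem hab c 0).1.trans (ht c 0))
  -- The two weights of a step add up to 1 and the opposite one is positive. This makes α strictly
  -- positive.
  have hs1 : ∀ c, s c < 1 := by
    intro c
    have h1 := hp (!c) 0
    have h2 := hs c 0
    cases c <;> simp only [moranWeight, Bool.not_true, Bool.not_false, if_true,
      Bool.false_eq_true, if_false] at h1 h2 <;> linarith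
  have key : ∀ d, 0 ≤ d → IsUpperPhiBound (fun _ => 0) (moranMeasure a b p) d →
      ∀ c, t c ^ d ≤ s c := by
    intro d hd h c
    have h1 : Tendsto (fun m : ℕ => t c - 1 / ((m : ℝ) + 1)) atTop (𝓝 (t c)) := by
      simpa using tendsto_one_div_add_atTop_nhds_zero_nat.const_sub (t c)
    have h2 : Tendsto (fun m : ℕ => s c + 1 / ((m : ℝ) + 1)) atTop (𝓝 (s c)) := by
      simpa using tendsto_one_div_add_atTop_nhds_zero_nat.const_add (s c)
    refine le_of_tendsto_of_tendsto (h1.rpow_const (Or.inr hd)) h2 ?_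
    filter_upwards [h1.eventually_const_lt (ht0 c)] with m hm
    have : 0 < 1 / ((m : ℝ) + 1) := by positivity
    exact rpow_le_of_isUpperPhiBound hA hAB hB hab hp hd h (by linarith [hs0 c]) hm (hrun c m)
  have hlog : ∀ c, Real.log (t c) < 0 := fun c =>
    Real.log_neg (ht0 c) ((htB c).trans_lt hB)
  rw [upperAssouadDim, upperPhiDim]
  split_ifs with h0
  · obtain ⟨c, hc⟩ : ∃ c, s c = 0 := h0.elim (fun h => ⟨_, h⟩) fun h => ⟨_, h⟩
    have : {d : ℝ | IsUpperPhiBound (fun _ => 0) (moranMeasure a b p) d} = ∅ := by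
      rw [Set.eq_empty_iff_forall_notMem]
      intro d hd
      -- `key` needs a nonnegative exponent, so a possibly negative `d` is first raised to `max d
      -- 0`. The conclusion, a positive power bounded by 0, is absurd.
      have h1 := key _ (le_max_right d 0) (IsUpperPhiBound.mono hd (le_max_left d 0)) c
      rw [hc] at h1
      exact (Real.rpow_pos_of_pos (ht0 c) _).not_ge h1
    rw [this, Set.image_empty, sInf_empty]
  · push Not at h0
    have hpos : ∀ c, 0 < s c := by
      intro c
      refine lt_of_le_of_ne (hs0 c) (Ne.symm ?_)
      cases c
      exacts [h0.1, h0.2]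
    have hα : ∀ c, 0 < Real.log (s c) / Real.log (t c) := fun c =>
      div_pos_of_neg_of_neg (Real.log_neg (hpos c) (hs1 c)) (hlog c)
    set α := max (Real.log (s false) / Real.log (t false)) (Real.log (s true) / Real.log (t true))
      with hαdef
    have hle : ∀ c, Real.log (s c) / Real.log (t c) ≤ α := by
      intro c
      cases c
      exacts [le_max_left _ _, le_max_right _ _]
    have hα0 : 0 < α := (hα false).trans_le (hle false)
    apply le_antisymm
    · refine sInf_le ⟨α, ?_, rfl⟩
      refine isUpperPhiBound_of_rpow_le hA hAB hB hab hp hα0.le fun c n => ?_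
      refine (Real.rpow_le_rpow (hA.le.trans (moranRatio_mem hab c n).1) (ht c n) hα0.le).trans
        (le_trans ?_ (hs c n))
      rw [Real.rpow_le_iff_le_log (ht0 c) (hpos c)]
      exact (div_le_iff_of_neg (hlog c)).1 (hle c)
    · refine le_sInf ?_
      rintro _ ⟨d, hd, rfl⟩
      rw [EReal.coe_le_coe_iff]
      have h1 : α ≤ max d 0 := by
        have h2 : ∀ c, Real.log (s c) / Real.log (t c) ≤ max d 0 := fun c => by
          rw [div_le_iff_of_neg (hlog c), ← Real.rpow_le_iff_le_log (ht0 c) (hpos c)]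
          exact key _ (le_max_right d 0) (IsUpperPhiBound.mono hd (le_max_left d 0)) c
        exact max_le (h2 _) (h2 _)
      rcases le_max_iff.1 h1 with h | h
      · exact h
      · linarith

theorem lowerAssouadDim_moranMeasure (hA : 0 < A) (hAB : A < B) (hB : B < 1)
    (hab : ∀ n, (a n, b n) ∈ ratioRegion A B) (hp : ∀ c n, 0 < moranWeight p c n)
    {s t : Bool → ℝ} (hs : ∀ c n, moranWeight p c n ≤ s c) (hs1 : ∀ c, s c ≤ 1)
    (ht : ∀ c n, t c ≤ moranRatio a b c n) (ht0 : ∀ c, 0 < t c)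
    (hrun : ∀ c (m k N : ℕ), ∃ n ≥ N, ∀ i < k,
      s c - 1 / ((m : ℝ) + 1) ≤ moranWeight p c (n + i) ∧
        moranRatio a b c (n + i) ≤ t c + 1 / ((m : ℝ) + 1)) :
    lowerAssouadDim (moranMeasure a b p) =
      ((min (Real.log (s false) / Real.log (t false))
        (Real.log (s true) / Real.log (t true)) : ℝ) : EReal) := by
  have hs0 : ∀ c, 0 < s c := fun c => (hp c 0).trans_le (hs c 0)
  have key : ∀ d, 0 ≤ d → IsLowerPhiBound (fun _ => 0) (moranMeasure a b p) d →
      ∀ c, s c ≤ t c ^ d := by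
    intro d hd h c
    have h1 : Tendsto (fun m : ℕ => t c + 1 / ((m : ℝ) + 1)) atTop (𝓝 (t c)) := by
      simpa using tendsto_one_div_add_atTop_nhds_zero_nat.const_add (t c)
    have h2 : Tendsto (fun m : ℕ => s c - 1 / ((m : ℝ) + 1)) atTop (𝓝 (s c)) := by
      simpa using tendsto_one_div_add_atTop_nhds_zero_nat.const_sub (s c)
    refine le_of_tendsto_of_tendsto h2 (h1.rpow_const (Or.inr hd)) ?_
    filter_upwards [h2.eventually_const_lt (hs0 c)] with m hm
    have : 0 < 1 / ((m : ℝ) + 1) := by positivity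
    exact le_rpow_of_isLowerPhiBound hA hAB hB hab hp hd h hm (by linarith [ht0 c]) (hrun c m)
  have hlog : ∀ c, Real.log (t c) < 0 := fun c =>
    Real.log_neg (ht0 c) (((ht c 0).trans (moranRatio_mem hab c 0).2).trans_lt hB)
  have hβ : ∀ c, 0 ≤ Real.log (s c) / Real.log (t c) := fun c =>
    div_nonneg_of_nonpos (Real.log_nonpos (hs0 c).le (hs1 c)) (hlog c).le
  set β := min (Real.log (s false) / Real.log (t false)) (Real.log (s true) / Real.log (t true))
    with hβdef
  have hle : ∀ c, β ≤ Real.log (s c) / Real.log (t c) := by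
    intro c
    cases c
    exacts [min_le_left _ _, min_le_right _ _]
  -- Here `s c = 1` is possible, so β may vanish; negative exponents are below it in any case.
  have hβ0 : 0 ≤ β := le_min (hβ _) (hβ _)
  rw [lowerAssouadDim, lowerPhiDim]
  apply le_antisymm
  · refine sSup_le ?_
    rintro _ ⟨d, hd, rfl⟩
    rw [EReal.coe_le_coe_iff]
    rcases le_total d 0 with hd0 | hd0
    · exact hd0.trans hβ0
    have h2 : ∀ c, d ≤ Real.log (s c) / Real.log (t c) := fun c => by
      rw [le_div_iff_of_neg (hlog c), ← Real.le_rpow_iff_log_le (hs0 c) (ht0 c)]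
      exact key _ hd0 hd c
    exact le_min (h2 _) (h2 _)
  · refine le_sSup ⟨β, ?_, rfl⟩
    refine isLowerPhiBound_of_le_rpow hA hAB hB hab hp hβ0 fun c n => ?_
    refine (hs c n).trans (le_trans ?_ (Real.rpow_le_rpow (ht0 c).le (ht c n) hβ0))
    rw [Real.le_rpow_iff_log_le (hs0 c) (ht0 c)]
    exact (le_div_iff_of_neg (hlog c)).1 (hle c)

end Values

/-! ### Long runs of independent events -/

section Runs

variable {Ω : Type*} [MeasurableSpace Ω] {P : Measure Ω}

/-- Independent events of equal positive probability almost surely occur in arbitrarily long and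
arbitrarily late runs. -/
theorem ProbabilityTheory.iIndepSet.ae_exists_run {E : ℕ → Set Ω} (hE : ∀ i, MeasurableSet (E i))
    (hind : iIndepSet E P) (hP : ∀ i, P (E i) = P (E 0)) (h0 : P (E 0) ≠ 0) :
    ∀ᵐ ω ∂P, ∀ k N : ℕ, ∃ n ≥ N, ∀ i < k, ω ∈ E (n + i) := by
  have := hind.isProbabilityMeasure
  rw [ae_all_iff]
  intro k
  rcases Nat.eq_zero_or_pos k with rfl | hk
  · exact Eventually.of_forall fun ω N => ⟨N, le_rfl, by simp⟩
  -- Consecutive blocks of length `k` use disjoint sets of indices, so these events are again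
  -- independent, each of probability P(E 0)^k > 0. The second Borel–Cantelli lemma then applies.
  let F : ℕ → Set Ω := fun j => ⋂ i ∈ Finset.range k, E (j * k + i)
  have hF : ∀ j, MeasurableSet (F j) := fun j => Finset.measurableSet_biInter _ fun _ _ => hE _
  have hinj : Function.Injective fun x : ℕ × Fin k => x.1 * k + x.2 := by
    rintro ⟨i, x⟩ ⟨j, y⟩ h
    simp only at h
    have h1 : (i * k + x) / k = i := by
      rw [mul_comm, Nat.mul_add_div hk, Nat.div_eq_of_lt x.2, add_zero]
    have h2 : (j * k + y) / k = j := by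
      rw [mul_comm, Nat.mul_add_div hk, Nat.div_eq_of_lt y.2, add_zero]
    have hij : i = j := by rw [← h1, h, h2]
    subst hij
    exact Prod.ext rfl (Fin.ext (by simpa using h))
  have hmeas : ∀ S : Finset ℕ, P (⋂ j ∈ S, F j) = ∏ _j ∈ S, P (E 0) ^ k := by
    intro S
    have hset : (⋂ j ∈ S, F j) =
        ⋂ m ∈ (S ×ˢ (Finset.univ : Finset (Fin k))).map ⟨_, hinj⟩, E m := by
      ext ω
      simp only [F, Set.mem_iInter, Finset.mem_map, Finset.mem_product, Finset.mem_univ, and_true,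
        Function.Embedding.coeFn_mk, Finset.mem_range]
      constructor
      · rintro h m ⟨x, hx, rfl⟩
        exact h x.1 hx x.2 x.2.2
      · intro h j hj i hi
        exact h _ ⟨(j, ⟨i, hi⟩), hj, rfl⟩
    rw [hset, (iIndepSet_iff_meas_biInter hE).1 hind, Finset.prod_congr rfl fun i _ => hP i]
    simp [← pow_mul, mul_comm]
  have hFP : ∀ j, P (F j) = P (E 0) ^ k := fun j => by simpa using hmeas {j}
  have hFind : iIndepSet F P := by
    rw [iIndepSet_iff_meas_biInter hF]
    intro S
    rw [hmeas, Finset.prod_congr rfl fun j _ => hFP j]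
  have hsum : ∑' j, P (F j) = ⊤ := by
    simp_rw [hFP]
    exact ENNReal.tsum_const_eq_top_of_ne_zero (pow_ne_zero _ h0)
  have hlim := measure_limsup_eq_one hF hFind hsum
  have hae : ∀ᵐ ω ∂P, ω ∈ limsup F atTop :=
    (mem_ae_iff_prob_eq_one (MeasurableSet.measurableSet_limsup hF)).2 hlim
  filter_upwards [hae] with ω hω N
  rw [mem_limsup_iff_frequently_mem, frequently_atTop] at hω
  obtain ⟨j, hj, hmem⟩ := hω N
  refine ⟨j * k, hj.trans (Nat.le_mul_of_pos_right j hk), fun i hi => ?_⟩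
  simp only [F, Set.mem_iInter, Finset.mem_range] at hmem
  exact hmem i hi

/-- Two independent sequences of independent, identically distributed variables almost surely
visit given sets of positive probability simultaneously, in arbitrarily long and late runs. -/
theorem ae_exists_run_of_indep {α β : Type*} [MeasurableSpace α] [MeasurableSpace β]
    {X : ℕ → Ω → α} {Y : ℕ → Ω → β} (hX : ∀ n, Measurable (X n)) (hY : ∀ n, Measurable (Y n))
    (hXi : iIndepFun X P) (hYi : iIndepFun Y P)
    (hXd : ∀ n, IdentDistrib (X n) (X 0) P P) (hYd : ∀ n, IdentDistrib (Y n) (Y 0) P P)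
    (hXY : IndepFun (fun ω n => X n ω) (fun ω n => Y n ω) P)
    {U : Set α} {V : Set β} (hU : MeasurableSet U) (hV : MeasurableSet V)
    (hU0 : P (X 0 ⁻¹' U) ≠ 0) (hV0 : P (Y 0 ⁻¹' V) ≠ 0) :
    ∀ᵐ ω ∂P, ∀ k N : ℕ, ∃ n ≥ N, ∀ i < k, X (n + i) ω ∈ U ∧ Y (n + i) ω ∈ V := by
  -- Independence of the two sequences separates `U` from `V`; independence within each sequence
  -- then factors each part.
  have hmeas : ∀ S : Finset ℕ, P (⋂ i ∈ S, (X i ⁻¹' U ∩ Y i ⁻¹' V)) =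
      ∏ _i ∈ S, (P (X 0 ⁻¹' U) * P (Y 0 ⁻¹' V)) := by
    intro S
    have h1 := hXY.measure_inter_preimage_eq_mul (Set.pi (S : Set ℕ) fun _ => U)
      (Set.pi (S : Set ℕ) fun _ => V)
      (MeasurableSet.pi S.countable_toSet fun _ _ => hU)
      (MeasurableSet.pi S.countable_toSet fun _ _ => hV)
    have h2 : (fun ω n => X n ω) ⁻¹' (Set.pi (S : Set ℕ) fun _ => U) = ⋂ i ∈ S, X i ⁻¹' U := by
      ext ω; simp [Set.mem_pi]
    have h3 : (fun ω n => Y n ω) ⁻¹' (Set.pi (S : Set ℕ) fun _ => V) = ⋂ i ∈ S, Y i ⁻¹' V := by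
      ext ω; simp [Set.mem_pi]
    have h4 : (⋂ i ∈ S, (X i ⁻¹' U ∩ Y i ⁻¹' V)) =
        (⋂ i ∈ S, X i ⁻¹' U) ∩ ⋂ i ∈ S, Y i ⁻¹' V := by
      ext ω
      simp only [Set.mem_iInter, Set.mem_inter_iff]
      exact ⟨fun h => ⟨fun i hi => (h i hi).1, fun i hi => (h i hi).2⟩,
        fun h i hi => ⟨h.1 i hi, h.2 i hi⟩⟩
    rw [h4, ← h2, ← h3, h1, h2, h3,
      hXi.measure_inter_preimage_eq_mul S (sets := fun _ => U) fun _ _ => hU,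
      hYi.measure_inter_preimage_eq_mul S (sets := fun _ => V) fun _ _ => hV,
      Finset.prod_mul_distrib, Finset.prod_congr rfl fun i _ => (hXd i).measure_preimage_eq hU,
      Finset.prod_congr rfl fun i _ => (hYd i).measure_preimage_eq hV]
  have hE : ∀ i, MeasurableSet (X i ⁻¹' U ∩ Y i ⁻¹' V) := fun i => (hX i hU).inter (hY i hV)
  have h1 : ∀ i, P (X i ⁻¹' U ∩ Y i ⁻¹' V) = P (X 0 ⁻¹' U) * P (Y 0 ⁻¹' V) := fun i => by
    simpa using hmeas {i}
  refine iIndepSet.ae_exists_run hE ?_ (fun i => (h1 i).trans (h1 0).symm) ?_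
  · rw [iIndepSet_iff_meas_biInter hE]
    intro S
    rw [hmeas, Finset.prod_congr rfl fun i _ => h1 i]
  · rw [h1]
    exact mul_ne_zero hU0 hV0

/-- A variable with a finite negative moment is almost surely positive. -/
theorem ae_pos_of_lintegral_rpow_neg_lt_top {f : Ω → ℝ} (hf : Measurable f) {t : ℝ} (ht : 0 < t)
    (h : ∫⁻ ω, ENNReal.ofReal (f ω) ^ (-t) ∂P < ⊤) : ∀ᵐ ω ∂P, 0 < f ω := by
  filter_upwards [ae_lt_top (by fun_prop) h.ne] with ω hω
  by_contra hle
  rw [ENNReal.ofReal_of_nonpos (not_lt.1 hle), ENNReal.zero_rpow_of_neg (by linarith)] at hω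
  exact lt_irrefl _ hω

/-! ### Essential bounds of bounded variables -/

section EssSup

variable {f : Ω → ℝ} {m M : ℝ}

theorem ae_essInf_le_and_le_essSup (h : ∀ ω, m ≤ f ω ∧ f ω ≤ M) :
    ∀ᵐ ω ∂P, essInf f P ≤ f ω ∧ f ω ≤ essSup f P := by
  filter_upwards [ae_essInf_le (μ := P) (isBoundedUnder_of ⟨m, fun ω => (h ω).1⟩),
    ae_le_essSup (μ := P) (isBoundedUnder_of ⟨M, fun ω => (h ω).2⟩)] with ω h1 h2 using ⟨h1, h2⟩

variable [IsProbabilityMeasure P]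

theorem le_essInf_of_forall (h : ∀ ω, m ≤ f ω ∧ f ω ≤ M) : m ≤ essInf f P :=
  le_essInf_of_ae_le m (Eventually.of_forall fun ω => (h ω).1)
    (isBoundedUnder_of ⟨M, fun ω => (h ω).2⟩).isCoboundedUnder_ge

theorem essSup_le_of_forall (h : ∀ ω, m ≤ f ω ∧ f ω ≤ M) : essSup f P ≤ M :=
  essSup_le_of_ae_le M (Eventually.of_forall fun ω => (h ω).2)
    (isBoundedUnder_of ⟨m, fun ω => (h ω).1⟩).isCoboundedUnder_le

/-- `essInf` is a liminf along `ae P`, so smaller values than `essInf f P + ε` occur frequently. The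
upper bound `M` supplies the coboundedness a real liminf requires. -/
theorem measure_le_essInf_add_ne_zero (h : ∀ ω, m ≤ f ω ∧ f ω ≤ M) {ε : ℝ} (hε : 0 < ε) :
    P {ω | f ω ≤ essInf f P + ε} ≠ 0 := by
  have h1 : ∃ᶠ ω in ae P, f ω < essInf f P + ε :=
    frequently_lt_of_liminf_lt (isBoundedUnder_of ⟨M, fun ω => (h ω).2⟩).isCoboundedUnder_ge
      (lt_add_of_pos_right _ hε)
  exact frequently_ae_iff.1 (h1.mono fun _ => le_of_lt)

theorem measure_essSup_sub_le_ne_zero (h : ∀ ω, m ≤ f ω ∧ f ω ≤ M) {ε : ℝ} (hε : 0 < ε) :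
    P {ω | essSup f P - ε ≤ f ω} ≠ 0 := by
  have h1 : ∃ᶠ ω in ae P, essSup f P - ε < f ω :=
    frequently_lt_of_lt_limsup (isBoundedUnder_of ⟨m, fun ω => (h ω).1⟩).isCoboundedUnder_le
      (sub_lt_self _ hε)
  exact frequently_ae_iff.1 (h1.mono fun _ => le_of_lt)

end EssSup

end Runs
-- The almost sure dimensions
theorem mainTheorem7 {Ω : Type*} [MeasurableSpace Ω] (P : Measure Ω) [IsProbabilityMeasure P]
    (A B : ℝ) (hA : 0 < A) (hAB : A < B) (hB : B < 1)
    (a b : ℕ → Ω → ℝ) (p : ℕ → Ω → unitInterval)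
    -- measurability, and the admissible range of the ratios
    (ha : ∀ n, Measurable (a n)) (hb : ∀ n, Measurable (b n)) (hp : ∀ n, Measurable (p n))
    (hab : ∀ n ω, (a n ω, b n ω) ∈ ratioRegion A B)
    -- the pairs of ratios are independent and identically distributed
    (hab_indep : iIndepFun (fun n ω => (a n ω, b n ω)) P)
    (hab_ident : ∀ n, IdentDistrib (fun ω => (a n ω, b n ω)) (fun ω => (a 0 ω, b 0 ω)) P P)
    -- so are the probabilities
    (hp_indep : iIndepFun p P)
    (hp_ident : ∀ n, IdentDistrib (p n) (p 0) P P)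
    -- the probabilities are independent of the ratios
    (h_indep : IndepFun (fun ω n => (a n ω, b n ω)) (fun ω n => p n ω) P)
    -- finite negative moments of the ratios and of the probabilities (`0 ^ (-t) = ∞`)
    (hab_mom : ∃ t : ℝ, 0 < t ∧ ∫⁻ ω, ENNReal.ofReal (a 0 ω) ^ (-t) ∂P < ⊤ ∧
      ∫⁻ ω, ENNReal.ofReal (b 0 ω) ^ (-t) ∂P < ⊤)
    (hp_mom : ∃ t : ℝ, 0 < t ∧ ∫⁻ ω, ENNReal.ofReal (p 0 ω : ℝ) ^ (-t) ∂P < ⊤ ∧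
      ∫⁻ ω, ENNReal.ofReal (1 - (p 0 ω : ℝ)) ^ (-t) ∂P < ⊤) :
    ∀ᵐ ω ∂P,
      upperAssouadDim (moranMeasure (fun n => a n ω) (fun n => b n ω) (fun n => p n ω)) =
          moranAlpha P (a 0) (b 0) (p 0) ∧
        lowerAssouadDim (moranMeasure (fun n => a n ω) (fun n => b n ω) (fun n => p n ω)) =
          (moranBeta P (a 0) (b 0) (p 0) : EReal) := by
  let X : ℕ → Ω → ℝ × ℝ := fun n ω => (a n ω, b n ω)
  have hX : ∀ n, Measurable (X n) := fun n => (ha n).prodMk (hb n)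
  -- The ratio and weight of a side are written as functions of the values of the variables, so that
  -- equality of laws and independence transfer statements about them from index 0.
  let ρ : Bool → ℝ × ℝ → ℝ := fun c z => if c then z.2 else z.1
  let w : Bool → unitInterval → ℝ := fun c y => if c then 1 - (y : ℝ) else (y : ℝ)
  have hρ : ∀ c, Measurable (ρ c) := by
    rintro (_ | _)
    exacts [measurable_fst, measurable_snd]
  have hw : ∀ c, Measurable (w c) := by
    rintro (_ | _)
    exacts [measurable_subtype_coe, measurable_subtype_coe.const_sub 1]
  let f : Bool → Ω → ℝ := fun c ω => ρ c (X 0 ω)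
  let g : Bool → Ω → ℝ := fun c ω => w c (p 0 ω)
  have hf : ∀ c ω, A ≤ f c ω ∧ f c ω ≤ B := fun c ω =>
    moranRatio_mem (fun n => hab n ω) c 0
  have hg : ∀ c ω, 0 ≤ g c ω ∧ g c ω ≤ 1 := by
    intro c ω
    have h0 := (p 0 ω).2.1
    have h1 := (p 0 ω).2.2
    cases c <;> simp [g, w, h0, h1]
  have hfae : ∀ᵐ ω ∂P, ∀ c n, essInf (f c) P ≤ ρ c (X n ω) ∧ ρ c (X n ω) ≤ essSup (f c) P := by
    rw [ae_all_iff]; intro c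
    rw [ae_all_iff]; intro n
    exact (hab_ident n).symm.ae_snd (p := fun z => essInf (f c) P ≤ ρ c z ∧ ρ c z ≤ essSup (f c) P)
      ((measurableSet_le measurable_const (hρ c)).inter (measurableSet_le (hρ c) measurable_const))
      (ae_essInf_le_and_le_essSup (hf c))
  -- The negative moments of the weights serve to make every weight almost surely positive, hence
  -- every Moran point a point of the support.
  have hgpos : ∀ c, ∀ᵐ ω ∂P, 0 < g c ω := by
    obtain ⟨t, ht, h1, h2⟩ := hp_mom
    rintro (_ | _)
    · exact ae_pos_of_lintegral_rpow_neg_lt_top ((hw false).comp (hp 0)) ht h1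
    · exact ae_pos_of_lintegral_rpow_neg_lt_top ((hw true).comp (hp 0)) ht h2
  have hgae : ∀ᵐ ω ∂P, ∀ c n, (essInf (g c) P ≤ w c (p n ω) ∧ w c (p n ω) ≤ essSup (g c) P) ∧
      0 < w c (p n ω) := by
    rw [ae_all_iff]; intro c
    rw [ae_all_iff]; intro n
    exact (hp_ident n).symm.ae_snd
      (p := fun y => (essInf (g c) P ≤ w c y ∧ w c y ≤ essSup (g c) P) ∧ 0 < w c y)
      (((measurableSet_le measurable_const (hw c)).inter
        (measurableSet_le (hw c) measurable_const)).inter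
        (measurableSet_lt measurable_const (hw c)))
      ((ae_essInf_le_and_le_essSup (hg c)).and (hgpos c))
  have hpos : ∀ m : ℕ, 0 < 1 / ((m : ℝ) + 1) := fun m => by positivity
  -- Large ratios and small weights can occur at the same indices because the weights are
  -- independent of the ratios.
  have hrun₁ : ∀ᵐ ω ∂P, ∀ c (m k N : ℕ), ∃ n ≥ N, ∀ i < k,
      essSup (f c) P - 1 / ((m : ℝ) + 1) ≤ ρ c (X (n + i) ω) ∧
        w c (p (n + i) ω) ≤ essInf (g c) P + 1 / ((m : ℝ) + 1) := by
    rw [ae_all_iff]; intro c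
    rw [ae_all_iff]; intro m
    exact ae_exists_run_of_indep hX hp hab_indep hp_indep hab_ident hp_ident h_indep
      (U := {z | essSup (f c) P - 1 / ((m : ℝ) + 1) ≤ ρ c z})
      (V := {y | w c y ≤ essInf (g c) P + 1 / ((m : ℝ) + 1)})
      (measurableSet_le measurable_const (hρ c)) (measurableSet_le (hw c) measurable_const)
      (measure_essSup_sub_le_ne_zero (hf c) (hpos m)) (measure_le_essInf_add_ne_zero (hg c) (hpos m))
  have hrun₂ : ∀ᵐ ω ∂P, ∀ c (m k N : ℕ), ∃ n ≥ N, ∀ i < k,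
      ρ c (X (n + i) ω) ≤ essInf (f c) P + 1 / ((m : ℝ) + 1) ∧
        essSup (g c) P - 1 / ((m : ℝ) + 1) ≤ w c (p (n + i) ω) := by
    rw [ae_all_iff]; intro c
    rw [ae_all_iff]; intro m
    exact ae_exists_run_of_indep hX hp hab_indep hp_indep hab_ident hp_ident h_indep
      (U := {z | ρ c z ≤ essInf (f c) P + 1 / ((m : ℝ) + 1)})
      (V := {y | essSup (g c) P - 1 / ((m : ℝ) + 1) ≤ w c y})
      (measurableSet_le (hρ c) measurable_const) (measurableSet_le measurable_const (hw c))
      (measure_le_essInf_add_ne_zero (hf c) (hpos m)) (measure_essSup_sub_le_ne_zero (hg c) (hpos m))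
  filter_upwards [hfae, hgae, hrun₁, hrun₂] with ω h1 h2 h3 h4
  constructor
  · refine (upperAssouadDim_moranMeasure (s := fun c => essInf (g c) P)
      (t := fun c => essSup (f c) P) hA hAB hB (fun n => hab n ω) (fun c n => (h2 c n).2)
      (fun c n => (h2 c n).1.1) (fun c => le_essInf_of_forall (hg c)) (fun c n => (h1 c n).2)
      (fun c => essSup_le_of_forall (hf c)) fun c m k N => ?_).trans rfl
    obtain ⟨n, hn, h⟩ := h3 c m k N
    exact ⟨n, hn, fun i hi => (h i hi).symm⟩
  · refine (lowerAssouadDim_moranMeasure (s := fun c => essSup (g c) P)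
      (t := fun c => essInf (f c) P) hA hAB hB (fun n => hab n ω) (fun c n => (h2 c n).2)
      (fun c n => (h2 c n).1.2) (fun c => essSup_le_of_forall (hg c)) (fun c n => (h1 c n).1)
      (fun c => hA.trans_le (le_essInf_of_forall (hf c))) fun c m k N => ?_).trans rfl
    obtain ⟨n, hn, h⟩ := h4 c m k N
    exact ⟨n, hn, fun i hi => (h i hi).symm⟩
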